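/- A super-operator is a completely positive, trace preserving linear map. Let $m,t\ge 0$ be integers and let $\mathcal K$ be a finite non-empty set of classical keys. A quantum authentication scheme assigns to each key $k\in\mathcal K$ a super-operator $A_k$ from operators on an $m$-qubit message system $M$ to operators on an $(m+t)$-qubit system $T$, and a super-operator $B_k$ from operators on $T$ to operators on $M\otimes V$, where $V$ is a single qubit with orthonormal basis $|\mathrm{acc}\rangle,|\mathrm{rej}\rangle$ (no restriction on the running time of $A_k$, $B_k$ is needed). For a unit vector $|\psi\rangle$ of $M$ let $$P_1^{|\psi\rangle}=|\psi\rangle\langle\psi|\otimes I_V+I_M\otimes|\mathrm{rej}\rangle\langle\mathrm{rej}|-|\psi\rangle\langle\psi|\otimes|\mathrm{rej}\rangle\langle\mathrm{rej}| .$$ The scheme is secure with error $\varepsilon$ if for every unit vector $|\psi\rangle$ of $M$ the following hold: (completeness) $B_k(A_k(|\psi\rangle\langle\psi|))=|\psi\rangle\langle\psi|\otimes|\mathrm{acc}\rangle\langle\mathrm{acc}|$ for every $k\in\mathcal K$; (soundness) for every super-operator $\mathcal O$ on operators on $T$, $$\mathrm{Tr}\Big(P_1^{|\psi\rangle}\,\frac1{|\mathcal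 K|}\sum_{k\in\mathcal K}B_k\big(\mathcal O(A_k(|\psi\rangle\langle\psi|))\big)\Big)\ge 1-\varepsilon .$$ **Theorem (Main Lower Bound).** Every quantum authentication scheme that is secure with error $\varepsilon$ is an encryption scheme with error at most $4\varepsilon^{1/6}$. That is, for any two (pure or mixed) density matrices $\sigma_0,\sigma_1$ of $M$, the encoded states $\rho_i=\frac1{|\mathcal K|}\sum_{k\in\mathcal K}A_k(\sigma_i)$ satisfy $$D(\rho_0,\rho_1)=\tfrac12\mathrm{Tr}\,|\rho_0-\rho_1|\le 4\varepsilon^{1/6}.$$ -/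

import Mathlib

open scoped MatrixOrder ComplexOrder Kronecker

noncomputable section

namespace QAuth

/-- The computational basis of an `n`-qubit system; operators on the system are the matrices
indexed by it. -/
abbrev Qubits (n : ℕ) : Type := Fin n → Fin 2

/-- The computational basis of the verification qubit `V`. -/
abbrev Verdict : Type := Fin 2

/-- The basis state `acc` of the verification qubit. -/
abbrev acc : Verdict := 0

/-- The basis state `rej` of the verification qubit. -/
abbrev rej : Verdict := 1

/-- The linear operators on the Hilbert space with orthonormal basis `a`. -/
abbrev Op (a : Type*) : Type _ := Matrix a a ℂ

/-- A unit vector. -/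
def IsPureState {a : Type*} [Fintype a] (ψ : a → ℂ) : Prop :=
  star ψ ⬝ᵥ ψ = 1

/-- The rank-one operator `|ψ⟩⟨ψ|`. -/
def proj {a : Type*} (ψ : a → ℂ) : Op a :=
  Matrix.vecMulVec ψ (star ψ)

/-- A density matrix: positive semidefinite of trace one. -/
structure IsDensity {a : Type*} [Fintype a] (ρ : Op a) : Prop where
  posSemidef : ρ.PosSemidef
  trace_eq_one : ρ.trace = 1

/-- The map `Φ ⊗ id` on operators on `a ⊗ ℂⁿ`: `Φ` is applied to each of the `n × n` blocks. -/
def amplify {a b : Type*} (Φ : Op a →ₗ[ℂ] Op b) (n : ℕ) (X : Op (a × Fin n)) :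
    Op (b × Fin n) :=
  Matrix.of fun p q => Φ (Matrix.of fun i j => X (i, p.2) (j, q.2)) p.1 q.1

/-- A super-operator (quantum channel): a completely positive and trace preserving
linear map. -/
structure IsSuperoperator {a b : Type*} [Fintype a] [Fintype b]
    (Φ : Op a →ₗ[ℂ] Op b) : Prop where
  completely_positive : ∀ (n : ℕ) (X : Op (a × Fin n)),
    X.PosSemidef → (amplify Φ n X).PosSemidef
  trace_preserving : ∀ X : Op a, (Φ X).trace = X.trace

/-- The trace distance `D(ρ, σ) = ½ Tr |ρ - σ|`, where `|X| = √(X† X)`. -/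
def traceDist {a : Type*} [Fintype a] [DecidableEq a] (ρ σ : Op a) : ℝ :=
  (1 / 2) * (CFC.abs (ρ - σ)).trace.re

/-- A quantum authentication scheme with key set `K`, for messages of `m` qubits and
transmissions of `m + t` qubits. `A k` and `B k` are the super-operators of the sender and of
the receiver for the key `k`; the output of `B k` is the message system and the qubit `V`. -/
structure QAS (m t : ℕ) (K : Type*) where
  A : K → Op (Qubits m) →ₗ[ℂ] Op (Qubits (m + t))
  B : K → Op (Qubits (m + t)) →ₗ[ℂ] Op (Qubits m × Verdict)
  isSuperoperator_A : ∀ k, IsSuperoperator (A k)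
  isSuperoperator_B : ∀ k, IsSuperoperator (B k)

/-- The projector `|acc⟩⟨acc|` on the verification qubit. -/
def accProj : Op Verdict := Matrix.single acc acc 1

/-- The projector `|rej⟩⟨rej|` on the verification qubit. -/
def rejProj : Op Verdict := Matrix.single rej rej 1

/-- The projector
`P₁ = |ψ⟩⟨ψ| ⊗ I + I ⊗ |rej⟩⟨rej| - |ψ⟩⟨ψ| ⊗ |rej⟩⟨rej|` of the test "the message is in state
`ψ`, or the verdict is `rej`". -/
def testProj {m : ℕ} (ψ : Qubits m → ℂ) : Op (Qubits m × Verdict) :=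
  proj ψ ⊗ₖ (1 : Op Verdict) + (1 : Op (Qubits m)) ⊗ₖ rejProj - proj ψ ⊗ₖ rejProj

namespace QAS

variable {m t : ℕ} {K : Type*} [Fintype K]

/-- The state transmitted on input `σ`, averaged over a uniformly random key. -/
def encoded (S : QAS m t K) (σ : Op (Qubits m)) : Op (Qubits (m + t)) :=
  (Fintype.card K : ℂ)⁻¹ • ∑ k, S.A k σ

/-- The receiver's output on input `ψ`, averaged over a uniformly random key, when the adversary
applies `O` to the transmitted system. -/
def received (S : QAS m t K) (O : Op (Qubits (m + t)) →ₗ[ℂ] Op (Qubits (m + t)))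
    (ψ : Qubits m → ℂ) : Op (Qubits m × Verdict) :=
  (Fintype.card K : ℂ)⁻¹ • ∑ k, S.B k (O (S.A k (proj ψ)))

/-- Security with error `ε` for the state `ψ`. -/
structure IsSecureFor (S : QAS m t K) (ε : ℝ) (ψ : Qubits m → ℂ) : Prop where
  completeness : ∀ k, S.B k (S.A k (proj ψ)) = proj ψ ⊗ₖ accProj
  soundness : ∀ O : Op (Qubits (m + t)) →ₗ[ℂ] Op (Qubits (m + t)), IsSuperoperator O →
    1 - ε ≤ (testProj ψ * S.received O ψ).trace.re

/-- Security with error `ε`, that is, for all pure states. -/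
def IsSecure (S : QAS m t K) (ε : ℝ) : Prop :=
  ∀ ψ : Qubits m → ℂ, IsPureState ψ → S.IsSecureFor ε ψ

/-- The scheme is an encryption scheme with error `δ`: any two encoded states, of pure or mixed
messages, are within trace distance `δ`. -/
def IsEncryption (S : QAS m t K) (δ : ℝ) : Prop :=
  ∀ σ₀ σ₁ : Op (Qubits m), IsDensity σ₀ → IsDensity σ₁ →
    traceDist (S.encoded σ₀) (S.encoded σ₁) ≤ δ

end QAS

end QAuth

end

namespace QAuth

open Matrix

/-! ### Positivity, channels and transition amplitudes -/

section General

variable {a b c : Type*} [Fintype a] [Fintype b] [Fintype c]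

/-! An observable that distinguishes two encoded messages is also an attack. Let `U` be the
Hermitian unitary sign of `ρ₀ - ρ₁`, so that `2 D(ρ₀, ρ₁) = Tr U (ρ₀ - ρ₁)`, and let the adversary
apply `U`.

For orthogonal `ψ`, `φ`, completeness makes the receiver recognise the encoding of `φ` with
certainty. By Cauchy–Schwarz, `|Tr U A_k(|ψ⟩⟨φ|)|²` is then at most the probability that the attack
turns `ψ` into an accepted `φ` (`normSq_trace_le`). Soundness bounds the key average of this
probability by `ε`, hence `|Tr U ρ(|ψ⟩⟨φ|)| ≤ √ε`, where `ρ` is the averaged encoding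
(`IsSecure.normSq_trace_encoded_le`).

Up to a multiple of the identity, `X ↦ Tr U ρ(X)` is `X ↦ Tr G X` with `G` Hermitian. Off-diagonal
elements of size at most `√ε` in every basis force the eigenvalues of `G` to lie within `2√ε` of
each other (`trace_mul_sub_trace_mul_le`). So `D ≤ √ε`, which is stronger than the stated bound when
`ε ≤ 1`. -/

theorem exists_eq_conjTranspose_mul_self {X : Op a} (hX : X.PosSemidef) :
    ∃ R : Op a, X = Rᴴ * R := by
  classical
  exact CStarAlgebra.nonneg_iff_eq_star_mul_self.mp hX.nonneg

theorem trace_mul_nonneg {X Y : Op a} (hX : X.PosSemidef) (hY : Y.PosSemidef) :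
    0 ≤ (X * Y).trace := by
  obtain ⟨R, rfl⟩ := exists_eq_conjTranspose_mul_self hX
  rw [Matrix.mul_assoc, Matrix.trace_mul_comm]
  exact (hY.mul_mul_conjTranspose_same R).trace_nonneg

/-- The Cauchy–Schwarz inequality for the Hilbert–Schmidt inner product. -/
theorem normSq_trace_conjTranspose_mul_le (X Y : Matrix a b ℂ) :
    ‖(Xᴴ * Y).trace‖ ^ 2 ≤ (Xᴴ * X).trace.re * (Yᴴ * Y).trace.re := by
  have key : ∀ Z W : Matrix a b ℂ,
      (Zᴴ * W).trace = ∑ p : b × a, star (Z p.2 p.1) * W p.2 p.1 := fun Z W => by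
    simp [Matrix.trace, Matrix.mul_apply, Fintype.sum_prod_type]
  have key' : ∀ Z : Matrix a b ℂ, (Zᴴ * Z).trace.re = ∑ p : b × a, ‖Z p.2 p.1‖ ^ 2 := fun Z => by
    rw [key, Complex.re_sum]
    refine Finset.sum_congr rfl fun p _ => ?_
    rw [Complex.star_def, ← Complex.normSq_eq_conj_mul_self, Complex.ofReal_re,
      Complex.normSq_eq_norm_sq]
  rw [key', key', key]
  refine le_trans (pow_le_pow_left₀ (norm_nonneg _) (norm_sum_le _ _) 2) ?_
  simp only [norm_mul, norm_star]
  exact Finset.sum_mul_sq_le_sq_mul_sq _ _ _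

theorem IsSuperoperator.posSemidef {Φ : Op a →ₗ[ℂ] Op b} (hΦ : IsSuperoperator Φ) {X : Op a}
    (hX : X.PosSemidef) : (Φ X).PosSemidef :=
  (hΦ.completely_positive 1 _ (hX.submatrix Prod.fst)).submatrix fun i => (i, (0 : Fin 1))

/-- A completely positive map sends the Gram matrix of `ψ` and `φ` to a Gram matrix. -/
theorem IsSuperoperator.exists_gram {Φ : Op a →ₗ[ℂ] Op b} (hΦ : IsSuperoperator Φ)
    (ψ φ : a → ℂ) : ∃ N₀ N₁ : Matrix (b × Fin 2) b ℂ,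
      Φ (vecMulVec ψ (star ψ)) = N₀ᴴ * N₀ ∧ Φ (vecMulVec ψ (star φ)) = N₀ᴴ * N₁ ∧
        Φ (vecMulVec φ (star φ)) = N₁ᴴ * N₁ := by
  let w : Fin 2 → a → ℂ := ![ψ, φ]
  -- The vector `ψ ⊗ e₀ + φ ⊗ e₁`: the blocks of its projector are the four operators `|w s⟩⟨w s'|`,
  -- so 2-positivity suffices.
  let v : a × Fin 2 → ℂ := fun p => w p.2 p.1
  obtain ⟨R, hR⟩ := exists_eq_conjTranspose_mul_self
    (hΦ.completely_positive 2 _ (posSemidef_vecMulVec_self_star v))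
  have key : ∀ s s' : Fin 2, Φ (vecMulVec (w s) (star (w s'))) =
      (R.submatrix id fun i => (i, s))ᴴ * R.submatrix id fun i => (i, s') := fun s s' => by
    ext i j
    exact congrFun₂ hR (i, s) (j, s')
  exact ⟨_, _, key 0 0, key 0 1, key 1 1⟩

/-- A positive functional on operators is of the form `X ↦ Tr (E X)` with `E` positive
semidefinite. -/
theorem exists_posSemidef_trace_mul (f : Op a →ₗ[ℂ] ℂ)
    (hf : ∀ X : Op a, X.PosSemidef → 0 ≤ f X) :
    ∃ E : Op a, E.PosSemidef ∧ ∀ X, f X = (E * X).trace := by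
  classical
  let E : Op a := Matrix.of fun j i => f (Matrix.single i j 1)
  have hE : ∀ X, f X = (E * X).trace := fun X => by
    conv_lhs => rw [Matrix.matrix_eq_sum_single X]
    simp only [map_sum, Matrix.trace, Matrix.diag_apply, Matrix.mul_apply]
    rw [Finset.sum_comm]
    refine Finset.sum_congr rfl fun j _ => Finset.sum_congr rfl fun i _ => ?_
    rw [← mul_one (X i j), ← smul_eq_mul, ← Matrix.smul_single, map_smul]
    simp [E, mul_comm]
  refine ⟨E, ?_, hE⟩
  have hq : ∀ x : a → ℂ, 0 ≤ star x ⬝ᵥ E *ᵥ x := fun x => by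
    have h := hf _ (posSemidef_vecMulVec_self_star x)
    rwa [hE, Matrix.mul_vecMulVec, Matrix.trace_vecMulVec, dotProduct_comm] at h
  -- Over `ℂ` a nonnegative quadratic form already forces `E` to be Hermitian.
  rw [← isPositive_toEuclideanLin_iff, LinearMap.isPositive_iff_complex]
  intro x
  have h : 0 ≤ inner ℂ (toEuclideanLin E x) x := by
    rw [← inner_conj_symm, EuclideanSpace.inner_eq_star_dotProduct, dotProduct_comm]
    exact star_nonneg_iff.mpr (hq x.ofLp)
  exact ⟨RCLike.conj_eq_iff_re.mp (RCLike.conj_eq_iff_im.mpr (RCLike.nonneg_iff.mp h).2),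
    (RCLike.nonneg_iff.mp h).1⟩

/-- Conjugation by a matrix. -/
def conj {d e : Type*} [Fintype d] (U : Matrix e d ℂ) : Op d →ₗ[ℂ] Op e where
  toFun X := U * X * Uᴴ
  map_add' X Y := by rw [Matrix.mul_add, Matrix.add_mul]
  map_smul' r X := by simp

theorem conj_apply {d e : Type*} [Fintype d] (U : Matrix e d ℂ) (X : Op d) :
    conj U X = U * X * Uᴴ := rfl

/-- Amplifying the map gives conjugation by `U ⊗ 1`. This makes a unitary an admissible attack. -/
theorem isSuperoperator_conj [DecidableEq a] {U : Matrix b a ℂ} (hU : Uᴴ * U = 1) :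
    IsSuperoperator (conj U) where
  completely_positive n X hX := by
    convert hX.mul_mul_conjTranspose_same (U ⊗ₖ (1 : Op (Fin n))) using 1
    ext p q
    simp [amplify, conj_apply, Matrix.mul_apply, Fintype.sum_prod_type, Matrix.one_apply,
      Finset.sum_mul, ite_mul, apply_ite]
  trace_preserving X := by
    rw [conj_apply, Matrix.trace_mul_comm, ← Matrix.mul_assoc, hU, Matrix.one_mul]

/-- A Hermitian matrix has a polar decomposition whose unitary factor is Hermitian. -/
theorem exists_isHermitian_mul_eq_abs [DecidableEq a] {X : Op a} (hX : X.IsHermitian) :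
    ∃ U : Op a, U.IsHermitian ∧ U * U = 1 ∧ U * X = CFC.abs X := by
  have hX' : IsSelfAdjoint X := hX
  have hc : ∀ f : ℝ → ℝ, ContinuousOn f (spectrum ℝ X) := fun f =>
    X.finite_real_spectrum.continuousOn f
  -- The value at `0` is `1`, not `0`, so that `s * s = 1` even when `X` is singular.
  let s : ℝ → ℝ := fun x => if 0 ≤ x then 1 else -1
  refine ⟨cfc s X, IsSelfAdjoint.cfc, ?_, ?_⟩
  · rw [← cfc_mul s s X (hc _) (hc _), ← cfc_one ℝ X]
    congr 1
    ext x
    by_cases h : 0 ≤ x <;> simp [s, h]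
  · rw [CFC.abs_eq_cfc_norm X hX']
    have hid : cfc s X * X = cfc s X * cfc (fun x : ℝ => x) X := by rw [cfc_id' ℝ X]
    rw [hid, ← cfc_mul s _ X (hc _) (hc _)]
    congr 1
    ext x
    by_cases h : 0 ≤ x
    · simp [s, h, abs_of_nonneg]
    · simp [s, h, abs_of_neg (not_le.mp h)]

/-- Half of `1 + U` is an orthogonal projection. -/
theorem posSemidef_one_add_of_mul_self [DecidableEq a] {U : Op a} (hU : U.IsHermitian)
    (hUU : U * U = 1) : (1 + U).PosSemidef := by
  have h : (1 + U) = (2 : ℂ)⁻¹ • ((1 + U)ᴴ * (1 + U)) := by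
    rw [conjTranspose_add, hU.eq, conjTranspose_one, Matrix.add_mul, Matrix.mul_add U,
      hUU, Matrix.one_mul, Matrix.mul_one, add_comm U 1, ← two_smul ℂ (1 + U), smul_smul]
    norm_num
  rw [h]
  exact (posSemidef_conjTranspose_mul_self _).smul (by positivity)

/-- If a measurement with effect `Q` after the channel `B ∘ A` detects `φ` with certainty, then
the amplitude with which `U` moves the encoding of `ψ` to that of `φ` bounds the probability that
`Q` accepts after `U` has acted on the encoding of `ψ`. -/
theorem normSq_trace_le [DecidableEq c]
    {A : Op a →ₗ[ℂ] Op b} {B : Op b →ₗ[ℂ] Op c}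
    (hA : IsSuperoperator A) (hB : IsSuperoperator B) {Q : Op c} (hQ : Q.PosSemidef)
    (hQ' : (1 - Q).PosSemidef) {ψ φ : a → ℂ} (hφ : IsPureState φ)
    (hBA : (Q * B (A (proj φ))).trace = 1) {U : Op b} (hU : U.IsHermitian) :
    ‖(U * A (vecMulVec ψ (star φ))).trace‖ ^ 2 ≤
      (Q * B (conj U (A (proj ψ)))).trace.re := by
  classical
  -- In the Heisenberg picture, `E` and `E'` are the effects `Q` and `1 - Q` pulled back through
  -- `B`; they sum to `1` because `B` preserves the trace.
  obtain ⟨E, hE, hfE⟩ := exists_posSemidef_trace_mul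
    ((traceLinearMap c ℂ ℂ) ∘ₗ (LinearMap.mulLeft ℂ Q) ∘ₗ B)
    fun X hX => trace_mul_nonneg hQ (hB.posSemidef hX)
  obtain ⟨E', hE', hfE'⟩ := exists_posSemidef_trace_mul
    ((traceLinearMap c ℂ ℂ) ∘ₗ (LinearMap.mulLeft ℂ (1 - Q)) ∘ₗ B)
    fun X hX => trace_mul_nonneg hQ' (hB.posSemidef hX)
  simp only [LinearMap.comp_apply, traceLinearMap_apply, LinearMap.mulLeft_apply] at hfE hfE'
  have hsum : E + E' = 1 := by
    refine Matrix.ext_iff_trace_mul_right.mpr fun X => ?_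
    rw [Matrix.add_mul, trace_add, ← hfE, ← hfE', ← trace_add, ← Matrix.add_mul,
      add_sub_cancel, Matrix.one_mul, Matrix.one_mul, hB.trace_preserving]
  obtain ⟨N₀, N₁, h00, h01, h11⟩ := hA.exists_gram ψ φ
  obtain ⟨R, hR⟩ := exists_eq_conjTranspose_mul_self hE
  obtain ⟨R', hR'⟩ := exists_eq_conjTranspose_mul_self hE'
  have htr : (E * A (proj φ)).trace = 1 := by rw [← hfE, hBA]
  have hφtr : (A (proj φ)).trace = 1 := by
    rw [hA.trace_preserving, proj, trace_vecMulVec, dotProduct_comm]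
    exact hφ
  -- The squared Hilbert–Schmidt norm of this product is `Tr E' A(|φ⟩⟨φ|)`, the probability of
  -- missing `φ`, which is zero. Hence `E` acts as the identity on the range of `N₁ᴴ`.
  have hzero : R' * N₁ᴴ = 0 := by
    rw [← trace_conjTranspose_mul_self_eq_zero_iff]
    have : (E' * A (proj φ)).trace = 0 := by
      have h := congrArg (fun Y => (Y * A (proj φ)).trace) hsum
      simp only [Matrix.add_mul, trace_add, Matrix.one_mul, htr, hφtr] at h
      simpa using h
    rw [proj, h11, hR'] at this
    rw [conjTranspose_mul, conjTranspose_conjTranspose, ← this, Matrix.mul_assoc, trace_mul_comm]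
    simp only [Matrix.mul_assoc]
  have hN : N₁ * E = N₁ := by
    have h1 : N₁ * E' = 0 := by
      have := congrArg conjTranspose hzero
      rw [conjTranspose_mul, conjTranspose_conjTranspose, conjTranspose_zero] at this
      rw [hR', ← Matrix.mul_assoc, this, Matrix.zero_mul]
    calc N₁ * E = N₁ * (E + E') := by rw [Matrix.mul_add, h1, add_zero]
      _ = N₁ := by rw [hsum, Matrix.mul_one]
  have hN' : E * N₁ᴴ = N₁ᴴ := by
    have := congrArg conjTranspose hN
    rwa [conjTranspose_mul, hE.isHermitian.eq] at this
  -- Since `E N₁ᴴ = N₁ᴴ`, the factor `E = Rᴴ R` can be inserted into the amplitude and split between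
  -- the two sides of Cauchy–Schwarz.
  have hcs := normSq_trace_conjTranspose_mul_le (R * U * N₀ᴴ) (R * N₁ᴴ)
  have e1 : ((R * U * N₀ᴴ)ᴴ * (R * N₁ᴴ)).trace
      = star (U * A (vecMulVec ψ (star φ))).trace := by
    rw [← trace_conjTranspose, h01]
    simp only [conjTranspose_mul, conjTranspose_conjTranspose, hU.eq]
    calc (N₀ * (U * Rᴴ) * (R * N₁ᴴ)).trace = (N₀ * (U * (E * N₁ᴴ))).trace := by
          rw [hR]; simp only [Matrix.mul_assoc]
      _ = (N₁ᴴ * N₀ * U).trace := by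
          rw [hN', trace_mul_comm, Matrix.mul_assoc, trace_mul_comm]
  have e2 : ((R * U * N₀ᴴ)ᴴ * (R * U * N₀ᴴ)).trace = (Q * B (conj U (A (proj ψ)))).trace := by
    rw [hfE, conj_apply, proj, h00]
    simp only [conjTranspose_mul, conjTranspose_conjTranspose, hU.eq]
    calc (N₀ * (U * Rᴴ) * (R * U * N₀ᴴ)).trace = (N₀ * U * (E * (U * N₀ᴴ))).trace := by
          rw [hR]; simp only [Matrix.mul_assoc]
      _ = (E * (U * (N₀ᴴ * N₀) * U)).trace := by
          rw [trace_mul_comm]; simp only [Matrix.mul_assoc]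
  have e3 : ((R * N₁ᴴ)ᴴ * (R * N₁ᴴ)).trace = 1 := by
    rw [← htr, proj, h11, hR, conjTranspose_mul, conjTranspose_conjTranspose, Matrix.mul_assoc,
      trace_mul_comm]
    simp only [Matrix.mul_assoc]
  rwa [e1, e2, e3, norm_star, Complex.one_re, mul_one] at hcs

end General

/-! ### Orthogonal pure states and the spread of a Hermitian operator -/

section Orthonormal

variable {a : Type*} [Fintype a]

theorem posSemidef_of_isHermitian_of_mul_self {P : Op a} (hP : P.IsHermitian)
    (hPP : P * P = P) : P.PosSemidef := by
  have h := posSemidef_conjTranspose_mul_self P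
  rwa [hP.eq, hPP] at h

theorem posSemidef_proj (ψ : a → ℂ) : (proj ψ).PosSemidef :=
  posSemidef_vecMulVec_self_star ψ

theorem trace_mul_vecMulVec_star (ψ φ : a → ℂ) (X : Op a) :
    (X * vecMulVec ψ (star φ)).trace = star φ ⬝ᵥ X *ᵥ ψ := by
  rw [Matrix.mul_vecMulVec, trace_vecMulVec, dotProduct_comm]

theorem IsPureState.trace_proj {ψ : a → ℂ} (hψ : IsPureState ψ) : (proj ψ).trace = 1 := by
  rw [proj, trace_vecMulVec, dotProduct_comm]
  exact hψ

theorem IsPureState.proj_mul_proj {ψ : a → ℂ} (hψ : IsPureState ψ) :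
    proj ψ * proj ψ = proj ψ := by
  rw [proj, vecMulVec_mul_vecMulVec, show star ψ ⬝ᵥ ψ = 1 from hψ, one_smul]

theorem proj_mul_proj_of_orthogonal {ψ φ : a → ℂ} (h : star ψ ⬝ᵥ φ = 0) :
    proj ψ * proj φ = 0 := by
  rw [proj, proj, vecMulVec_mul_vecMulVec, h, zero_smul, vecMulVec_zero]

theorem star_dotProduct_eq_zero_symm {ψ φ : a → ℂ} (h : star ψ ⬝ᵥ φ = 0) :
    star φ ⬝ᵥ ψ = 0 := by
  rw [star_dotProduct, h, star_zero]

theorem posSemidef_one_sub_proj [DecidableEq a] {ψ : a → ℂ} (hψ : IsPureState ψ) :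
    (1 - proj ψ).PosSemidef := by
  refine posSemidef_of_isHermitian_of_mul_self
    (isHermitian_one.sub (posSemidef_proj ψ).isHermitian) ?_
  simp only [mul_sub, sub_mul, mul_one, one_mul, hψ.proj_mul_proj]
  abel

theorem posSemidef_one_sub_proj_sub_proj [DecidableEq a] {ψ φ : a → ℂ} (hψ : IsPureState ψ)
    (hφ : IsPureState φ) (h : star ψ ⬝ᵥ φ = 0) : (1 - proj ψ - proj φ).PosSemidef := by
  refine posSemidef_of_isHermitian_of_mul_self
    ((isHermitian_one.sub (posSemidef_proj ψ).isHermitian).sub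
      (posSemidef_proj φ).isHermitian) ?_
  simp only [mul_sub, sub_mul, mul_one, one_mul, hψ.proj_mul_proj, hφ.proj_mul_proj,
    proj_mul_proj_of_orthogonal h, proj_mul_proj_of_orthogonal (star_dotProduct_eq_zero_symm h)]
  abel

/-- A Hermitian operator all of whose off-diagonal elements are at most `δ` has expectation values
that differ by at most `2 δ`. -/
theorem trace_mul_sub_trace_mul_le [DecidableEq a] {G : Op a} (hG : G.IsHermitian) {δ : ℝ}
    (hδ : 0 ≤ δ)
    (h : ∀ ψ φ : a → ℂ, IsPureState ψ → IsPureState φ → star ψ ⬝ᵥ φ = 0 →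
      ‖(G * vecMulVec ψ (star φ)).trace‖ ≤ δ)
    {σ₀ σ₁ : Op a} (h₀ : IsDensity σ₀) (h₁ : IsDensity σ₁) :
    (G * σ₀).trace.re - (G * σ₁).trace.re ≤ 2 * δ := by
  let v : a → a → ℂ := fun i => (hG.eigenvectorBasis i).ofLp
  have hGv : ∀ i, G *ᵥ v i = (hG.eigenvalues i : ℂ) • v i := fun i => by
    rw [hG.mulVec_eigenvectorBasis i]; rfl
  have hv : ∀ i j, star (v i) ⬝ᵥ v j = if i = j then 1 else 0 := fun i j => by
    rw [← orthonormal_iff_ite.mp hG.eigenvectorBasis.orthonormal i j,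
      EuclideanSpace.inner_eq_star_dotProduct, dotProduct_comm]
  have hgap : ∀ i j, hG.eigenvalues i - hG.eigenvalues j ≤ 2 * δ := fun i j => by
    by_cases hij : i = j
    · rw [hij, sub_self]; positivity
    -- For eigenvectors `v i`, `v j`, the orthonormal pair `(v i ± v j) / √2` turns half the
    -- eigenvalue gap into an off-diagonal element.
    let r : ℂ := ((√2)⁻¹ : ℝ)
    have hr : star r = r := Complex.conj_ofReal _
    have hrr : r * r = 1 / 2 := by
      rw [← Complex.ofReal_mul, ← mul_inv, Real.mul_self_sqrt (by norm_num)]; norm_num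
    have hb := h (r • (v i + v j)) (r • (v i - v j))
      (by simp [IsPureState, hv, hij, Ne.symm hij, hr]; linear_combination 2 * hrr)
      (by simp [IsPureState, hv, hij, Ne.symm hij, hr]; linear_combination 2 * hrr)
      (by simp [hv, hij, Ne.symm hij, hr])
    have hval : (G * vecMulVec (r • (v i + v j)) (star (r • (v i - v j)))).trace =
        (((hG.eigenvalues i - hG.eigenvalues j) / 2 : ℝ) : ℂ) := by
      rw [trace_mul_vecMulVec_star]
      simp [mulVec_smul, mulVec_add, hGv, hv, hij, Ne.symm hij, hr]
      linear_combination ((hG.eigenvalues i : ℂ) - hG.eigenvalues j) * hrr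
    rw [hval, Complex.norm_real, Real.norm_eq_abs] at hb
    linarith [le_abs_self ((hG.eigenvalues i - hG.eigenvalues j) / 2)]
  let W : Op a := hG.eigenvectorUnitary
  have hWW : W * Wᴴ = 1 := Unitary.mul_star_self_of_mem hG.eigenvectorUnitary.2
  have hspec : G = W * diagonal (fun i => (hG.eigenvalues i : ℂ)) * Wᴴ := by
    conv_lhs => rw [hG.spectral_theorem]
    rfl
  let p : Op a → a → ℝ := fun σ i => ((Wᴴ * σ * W) i i).re
  have hp : ∀ σ, IsDensity σ → ∀ i, 0 ≤ p σ i := fun σ hσ i =>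
    (RCLike.nonneg_iff.mp (hσ.posSemidef.conjTranspose_mul_mul_same W).diag_nonneg).1
  have hp1 : ∀ σ, IsDensity σ → ∑ i, p σ i = 1 := fun σ hσ => by
    have : (Wᴴ * σ * W).trace = 1 := by
      rw [trace_mul_comm, ← Matrix.mul_assoc, hWW, Matrix.one_mul, hσ.trace_eq_one]
    rw [← Complex.re_sum]
    exact congrArg Complex.re this
  have htr : ∀ σ, (G * σ).trace.re = ∑ i, hG.eigenvalues i * p σ i := fun σ => by
    have : (G * σ).trace = (diagonal (fun i => (hG.eigenvalues i : ℂ)) * (Wᴴ * σ * W)).trace := by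
      conv_lhs => rw [hspec, Matrix.mul_assoc, Matrix.mul_assoc, trace_mul_comm]
      simp only [Matrix.mul_assoc]
    rw [this, Matrix.trace, Complex.re_sum]
    refine Finset.sum_congr rfl fun i _ => ?_
    rw [diag_apply, diagonal_mul, Complex.re_ofReal_mul]
  -- Both expectations become averages over the product of the two eigenvalue distributions, so
  -- their difference is an average of eigenvalue gaps.
  have e₀ : (G * σ₀).trace.re = ∑ i, ∑ j, p σ₀ i * p σ₁ j * hG.eigenvalues i := by
    rw [htr]
    refine Finset.sum_congr rfl fun i _ => ?_
    rw [← Finset.sum_mul, ← Finset.mul_sum, hp1 σ₁ h₁]; ring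
  have e₁ : (G * σ₁).trace.re = ∑ i, ∑ j, p σ₀ i * p σ₁ j * hG.eigenvalues j := by
    rw [htr, Finset.sum_comm]
    refine Finset.sum_congr rfl fun j _ => ?_
    rw [← Finset.sum_mul, ← Finset.sum_mul, hp1 σ₀ h₀]; ring
  rw [e₀, e₁, ← Finset.sum_sub_distrib]
  calc ∑ i, (∑ j, p σ₀ i * p σ₁ j * hG.eigenvalues i - ∑ j, p σ₀ i * p σ₁ j * hG.eigenvalues j)
      ≤ ∑ i, ∑ j, p σ₀ i * p σ₁ j * (2 * δ) := by
        refine Finset.sum_le_sum fun i _ => ?_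
        rw [← Finset.sum_sub_distrib]
        refine Finset.sum_le_sum fun j _ => ?_
        rw [← mul_sub]
        exact mul_le_mul_of_nonneg_left (hgap i j) (mul_nonneg (hp σ₀ h₀ i) (hp σ₁ h₁ j))
    _ = 2 * δ := by
        simp only [← Finset.sum_mul, ← Finset.mul_sum, hp1 σ₁ h₁, hp1 σ₀ h₀, mul_one, one_mul]

end Orthonormal

/-! ### The receiver's tests -/

theorem posSemidef_accProj : accProj.PosSemidef := by
  rw [accProj, ← diagonal_single]
  refine PosSemidef.diagonal fun i => ?_
  fin_cases i <;> simp

theorem posSemidef_rejProj : rejProj.PosSemidef := by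
  rw [rejProj, ← diagonal_single]
  refine PosSemidef.diagonal fun i => ?_
  fin_cases i <;> simp

theorem accProj_add_rejProj : accProj + rejProj = 1 := by
  ext i j
  fin_cases i <;> fin_cases j <;> simp [accProj, rejProj]

theorem trace_accProj_mul_accProj : (accProj * accProj).trace = 1 := by
  simp [accProj]

theorem one_eq_kronecker_accProj_add (a : Type*) [DecidableEq a] :
    (1 : Op (a × Verdict)) = (1 : Op a) ⊗ₖ accProj + (1 : Op a) ⊗ₖ rejProj := by
  rw [← kronecker_add, accProj_add_rejProj, one_kronecker_one]

theorem testProj_eq {m : ℕ} (ψ : Qubits m → ℂ) :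
    testProj ψ = proj ψ ⊗ₖ accProj + (1 : Op (Qubits m)) ⊗ₖ rejProj := by
  rw [testProj, ← accProj_add_rejProj, kronecker_add]
  abel

theorem sub_kronecker {a b : Type*} (X Y : Op a) (Z : Op b) :
    (X - Y) ⊗ₖ Z = X ⊗ₖ Z - Y ⊗ₖ Z := by
  ext i j
  simp [sub_mul]

theorem posSemidef_one_sub_proj_kronecker {a : Type*} [Fintype a] [DecidableEq a] {φ : a → ℂ}
    (hφ : IsPureState φ) : (1 - proj φ ⊗ₖ accProj).PosSemidef := by
  have h : 1 - proj φ ⊗ₖ accProj = (1 - proj φ) ⊗ₖ accProj + (1 : Op a) ⊗ₖ rejProj := by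
    rw [one_eq_kronecker_accProj_add, sub_kronecker]; abel
  rw [h]
  exact ((posSemidef_one_sub_proj hφ).kronecker posSemidef_accProj).add
    (PosSemidef.one.kronecker posSemidef_rejProj)

/-- Passing the test for `ψ` and being accepted as `φ` are mutually exclusive outcomes: the two
projectors are orthogonal. -/
theorem posSemidef_one_sub_testProj_sub {m : ℕ} {ψ φ : Qubits m → ℂ} (hψ : IsPureState ψ)
    (hφ : IsPureState φ) (h : star ψ ⬝ᵥ φ = 0) :
    (1 - testProj ψ - proj φ ⊗ₖ accProj).PosSemidef := by
  have h' : 1 - testProj ψ - proj φ ⊗ₖ accProj = (1 - proj ψ - proj φ) ⊗ₖ accProj := by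
    rw [testProj_eq, one_eq_kronecker_accProj_add, sub_kronecker, sub_kronecker]; abel
  rw [h']
  exact (posSemidef_one_sub_proj_sub_proj hψ hφ h).kronecker posSemidef_accProj

/-! ### Averaging over the keys: authentication implies encryption -/

namespace QAS

variable {m t : ℕ} {K : Type*} [Fintype K] (S : QAS m t K)

/-- `QAS.encoded` as a linear map. -/
noncomputable def encodedLinear : Op (Qubits m) →ₗ[ℂ] Op (Qubits (m + t)) :=
  (Fintype.card K : ℂ)⁻¹ • ∑ k, S.A k

theorem encodedLinear_apply (σ : Op (Qubits m)) : S.encodedLinear σ = S.encoded σ := by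
  simp [encodedLinear, encoded]

theorem posSemidef_encoded {σ : Op (Qubits m)} (hσ : σ.PosSemidef) :
    (S.encoded σ).PosSemidef :=
  (posSemidef_sum _ fun k _ => (S.isSuperoperator_A k).posSemidef hσ).smul (by positivity)

variable [Nonempty K]

theorem trace_encoded (σ : Op (Qubits m)) : (S.encoded σ).trace = σ.trace := by
  simp [encoded, trace_sum, (S.isSuperoperator_A _).trace_preserving]

variable {S} {ε : ℝ}

/-- With no tampering the test passes with probability exactly `1`, so soundness reads `1 - ε ≤ 1`.
-/
theorem IsSecure.nonneg (hS : S.IsSecure ε) : 0 ≤ ε := by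
  let ψ : Qubits m → ℂ := Pi.single 0 1
  have hψ : IsPureState ψ := by simp [IsPureState, ψ]
  have hid : IsSuperoperator (conj (1 : Op (Qubits (m + t)))) := isSuperoperator_conj (by simp)
  have h := (hS ψ hψ).soundness _ hid
  have hrec : S.received (conj 1) ψ = proj ψ ⊗ₖ accProj := by
    have hcard : (Fintype.card K : ℂ) ≠ 0 := Nat.cast_ne_zero.mpr Fintype.card_ne_zero
    simp only [received, conj_apply, Matrix.one_mul, conjTranspose_one, Matrix.mul_one,
      (hS ψ hψ).completeness, Finset.sum_const, Finset.card_univ]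
    rw [← Nat.cast_smul_eq_nsmul ℂ, smul_smul, inv_mul_cancel₀ hcard, one_smul]
  rw [hrec, testProj_eq, Matrix.add_mul, ← mul_kronecker_mul, ← mul_kronecker_mul, trace_add,
    trace_kronecker, trace_kronecker, trace_accProj_mul_accProj, hψ.proj_mul_proj,
    hψ.trace_proj] at h
  simp [accProj, rejProj] at h
  exact h

/-- The attack is conjugation by `U`. For each key the squared amplitude is at most the probability
of an accepted `φ`, hence at most that of failing the test for `ψ`; convexity of the square passes
to the key average. -/
theorem IsSecure.normSq_trace_encoded_le (hS : S.IsSecure ε) {ψ φ : Qubits m → ℂ}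
    (hψ : IsPureState ψ) (hφ : IsPureState φ) (hψφ : star ψ ⬝ᵥ φ = 0)
    {U : Op (Qubits (m + t))} (hU : U.IsHermitian) (hUU : U * U = 1) :
    ‖(U * S.encoded (vecMulVec ψ (star φ))).trace‖ ^ 2 ≤ min ε 1 := by
  have hsup : IsSuperoperator (conj U) := isSuperoperator_conj (by rw [hU.eq, hUU])
  set Q : Op (Qubits m × Verdict) := proj φ ⊗ₖ accProj with hQdef
  have hQ : Q.PosSemidef := (posSemidef_proj φ).kronecker posSemidef_accProj
  have hQ' : (1 - Q).PosSemidef := posSemidef_one_sub_proj_kronecker hφ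
  let Y : K → Op (Qubits m × Verdict) := fun k => S.B k (conj U (S.A k (proj ψ)))
  have hY : ∀ k, (Y k).PosSemidef := fun k => (S.isSuperoperator_B k).posSemidef
    (hsup.posSemidef ((S.isSuperoperator_A k).posSemidef (posSemidef_proj ψ)))
  have hYtr : ∀ k, (Y k).trace = 1 := fun k => by
    rw [(S.isSuperoperator_B k).trace_preserving, hsup.trace_preserving,
      (S.isSuperoperator_A k).trace_preserving, hψ.trace_proj]
  let z : K → ℂ := fun k => (U * S.A k (vecMulVec ψ (star φ))).trace
  have hz : ∀ k, ‖z k‖ ^ 2 ≤ (Q * Y k).trace.re := fun k => by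
    refine normSq_trace_le (S.isSuperoperator_A k) (S.isSuperoperator_B k) hQ hQ' hφ ?_ hU
    rw [(hS φ hφ).completeness k, ← mul_kronecker_mul, trace_kronecker, hφ.proj_mul_proj,
      hφ.trace_proj, trace_accProj_mul_accProj, one_mul]
  have hz1 : ∀ k, ‖z k‖ ^ 2 ≤ 1 := fun k => by
    have h := (RCLike.nonneg_iff.mp (trace_mul_nonneg hQ' (hY k))).1
    rw [Matrix.sub_mul, Matrix.one_mul, trace_sub, hYtr] at h
    simp at h
    exact (hz k).trans h
  have hzt : ∀ k, ‖z k‖ ^ 2 ≤ 1 - (testProj ψ * Y k).trace.re := fun k => by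
    have h := (RCLike.nonneg_iff.mp
      (trace_mul_nonneg (posSemidef_one_sub_testProj_sub hψ hφ hψφ) (hY k))).1
    rw [Matrix.sub_mul, Matrix.sub_mul, Matrix.one_mul, trace_sub, trace_sub, hYtr] at h
    simp at h
    linarith [hz k]
  set n : ℝ := (Fintype.card K : ℝ) with hn
  have hn0 : 0 < n := by rw [hn]; exact_mod_cast Fintype.card_pos
  have hsound := (hS ψ hψ).soundness _ hsup
  have hrec : (testProj ψ * S.received (conj U) ψ).trace.re =
      n⁻¹ * ∑ k, (testProj ψ * Y k).trace.re := by
    rw [received, Matrix.mul_smul, trace_smul, Matrix.mul_sum, trace_sum, smul_eq_mul,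
      ← Complex.re_sum, hn, ← Complex.re_ofReal_mul]
    norm_num [Y]
  have henc : (U * S.encoded (vecMulVec ψ (star φ))).trace = (n : ℂ)⁻¹ * ∑ k, z k := by
    rw [encoded, Matrix.mul_smul, trace_smul, Matrix.mul_sum, trace_sum, smul_eq_mul, hn]
    norm_num [z]
  have hjensen : ‖(n : ℂ)⁻¹ * ∑ k, z k‖ ^ 2 ≤ n⁻¹ * ∑ k, ‖z k‖ ^ 2 := by
    have h1 : (∑ k, ‖z k‖) ^ 2 ≤ n * ∑ k, ‖z k‖ ^ 2 := sq_sum_le_card_mul_sum_sq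
    have h2 : ‖∑ k, z k‖ ^ 2 ≤ n * ∑ k, ‖z k‖ ^ 2 :=
      (pow_le_pow_left₀ (norm_nonneg _) (norm_sum_le _ _) 2).trans h1
    rw [norm_mul, norm_inv, Complex.norm_real, Real.norm_of_nonneg hn0.le, mul_pow]
    calc n⁻¹ ^ 2 * ‖∑ k, z k‖ ^ 2 ≤ n⁻¹ ^ 2 * (n * ∑ k, ‖z k‖ ^ 2) := by gcongr
      _ = n⁻¹ * ∑ k, ‖z k‖ ^ 2 := by field_simp
  rw [henc]
  refine hjensen.trans (le_min ?_ ?_)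
  · have h : ∑ k, ‖z k‖ ^ 2 ≤ n - ∑ k, (testProj ψ * Y k).trace.re := by
      refine (Finset.sum_le_sum fun k _ => hzt k).trans_eq ?_
      simp [hn]
    rw [hrec] at hsound
    calc n⁻¹ * ∑ k, ‖z k‖ ^ 2 ≤ n⁻¹ * (n - ∑ k, (testProj ψ * Y k).trace.re) := by gcongr
      _ = 1 - n⁻¹ * ∑ k, (testProj ψ * Y k).trace.re := by field_simp
      _ ≤ ε := by linarith
  · have h : ∑ k, ‖z k‖ ^ 2 ≤ n :=
      (Finset.sum_le_sum fun k _ => hz1 k).trans_eq (by simp [hn])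
    calc n⁻¹ * ∑ k, ‖z k‖ ^ 2 ≤ n⁻¹ * n := by gcongr
      _ = 1 := by field_simp

/-- A secure authentication scheme encrypts, with an error at most the square root of its own. -/
theorem IsSecure.isEncryption_sqrt (hS : S.IsSecure ε) : S.IsEncryption √(min ε 1) := by
  intro σ₀ σ₁ h₀ h₁
  obtain ⟨U, hU, hUU, hUabs⟩ := exists_isHermitian_mul_eq_abs
    ((S.posSemidef_encoded h₀.posSemidef).isHermitian.sub
      (S.posSemidef_encoded h₁.posSemidef).isHermitian)
  -- The shift from `U` to `1 + U` makes the functional positive, so that `G` exists and is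
  -- Hermitian. It only adds `Tr X`, which vanishes on `|ψ⟩⟨φ|` for orthogonal vectors and cancels
  -- between density matrices.
  obtain ⟨G, hG, hfG⟩ := exists_posSemidef_trace_mul
    (traceLinearMap (Qubits (m + t)) ℂ ℂ ∘ₗ LinearMap.mulLeft ℂ (1 + U) ∘ₗ S.encodedLinear)
    fun X hX => by
      simp only [LinearMap.comp_apply, encodedLinear_apply]
      exact trace_mul_nonneg (posSemidef_one_add_of_mul_self hU hUU) (S.posSemidef_encoded hX)
  have hUG : ∀ X, (U * S.encoded X).trace = (G * X).trace - X.trace := fun X => by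
    rw [← hfG]
    simp only [LinearMap.comp_apply, encodedLinear_apply, traceLinearMap_apply,
      LinearMap.mulLeft_apply]
    rw [Matrix.add_mul, Matrix.one_mul, trace_add, trace_encoded, add_sub_cancel_left]
  have hmain := trace_mul_sub_trace_mul_le hG.isHermitian (Real.sqrt_nonneg (min ε 1))
    (fun ψ φ hψ hφ h => by
      have hb := hS.normSq_trace_encoded_le hψ hφ h hU hUU
      rw [hUG, trace_vecMulVec, dotProduct_comm, star_dotProduct_eq_zero_symm h, sub_zero] at hb
      exact Real.le_sqrt_of_sq_le hb) h₀ h₁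
  rw [traceDist, ← hUabs, Matrix.mul_sub, trace_sub, hUG, hUG, h₀.trace_eq_one, h₁.trace_eq_one]
  simp only [Complex.sub_re]
  linarith

end QAS

end QAuth

theorem mainTheorem2 {m t : ℕ} {K : Type*} [Fintype K] [Nonempty K]
    (S : QAuth.QAS m t K) (ε : ℝ) (hS : S.IsSecure ε) :
    S.IsEncryption (4 * ε ^ ((1 : ℝ) / 6)) := by
  intro σ₀ σ₁ h₀ h₁
  refine (hS.isEncryption_sqrt σ₀ σ₁ h₀ h₁).trans ?_
  have hε := hS.nonneg
  -- The cap at `1` is needed here: for `ε > 1` the square root exceeds the sixth root, but `1` does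
  -- not.
  have hle : √(min ε 1) ≤ ε ^ ((1 : ℝ) / 6) := by
    rcases le_total ε 1 with h | h
    · rw [min_eq_left h, Real.sqrt_eq_rpow]
      exact Real.rpow_le_rpow_of_exponent_ge_of_imp hε h (by norm_num) (by norm_num)
    · rw [min_eq_right h, Real.sqrt_one]
      exact Real.one_le_rpow h (by norm_num)
  linarith [Real.rpow_nonneg hε ((1 : ℝ) / 6)]
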